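/- Let $b=\lambda+i\eta$ with $\lambda,\eta\in\mathbb R$, let $k\ge 0$ be an integer, and put $$c_n^{(b)}=\frac{\eta}{\lambda+n-1},\qquad d_{n+1}^{(\lambda)}=\frac14\,\frac{n(n+2\lambda-1)}{(n+\lambda-1)(n+\lambda)},\qquad n\ge 1 .$$ The $k$-th associated complementary Romanovski–Routh (CRR) polynomials are given by $\mathcal P_0^{(k)}(b;x)=1$, $\mathcal P_1^{(k)}(b;x)=x-c_{k+1}^{(b)}$ and $$\mathcal P_{n+1}^{(k)}(b;x)=(x-c_{k+n+1}^{(b)})\,\mathcal P_n^{(k)}(b;x)-d_{k+n+1}^{(\lambda)}(x^2+1)\,\mathcal P_{n-1}^{(k)}(b;x),\qquad n\ge1 .$$ Assume that either $k=0$ and $\lambda>1/2$, or $k\ge1$ and $\lambda>0$. For $n\ge 1$ let $$M_n^{(\lambda;k)}=\frac12\,\frac{k+n-1}{\lambda+k+n-1}\ \text{ if } 0<\lambda\le\tfrac12,\qquad M_n^{(\lambda;k)}=\frac12\,\frac{2\lambda+k+n-2}{\lambda+k+n-1}\ \text{ if } \lambda>\tfrac12 .$$ Then $\{M_n^{(\lambda;k)}\}_{n\ge1}$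 is the maximal parameter sequence of the positive chain sequence $\{d_{k+n}^{(\lambda)}\}_{n\ge2}$; that is, among all sequences $(g_n)_{n\ge1}$ with $0\le g_1<1$, $0<g_n<1$ for $n\ge2$ and $d_{k+n+1}^{(\lambda)}=(1-g_n)g_{n+1}$ for $n\ge1$, it is the termwise largest. Let $\nu^{(b;k)}$ be the probability measure on the unit circle, not supported on finitely many points, whose Verblunsky coefficients $\beta_{n-1}=-\overline{\Phi_n(0)}$, $n\ge 1$ (where $\Phi_n$ is the monic orthogonal polynomial of degree $n$ for the measure), are $$\beta_{n-1}^{(b;k)}=\frac{1}{\tau_{n-1}^{(b;k)}}\,\frac{1-2M_n^{(\lambda;k)}-ic_{k+n}^{(b)}}{1-ic_{k+n}^{(b)}},\quad n\ge1,\qquad \tau_0^{(b;k)}=1,\quad \tau_n^{(b;k)}=\tau_{n-1}^{(b;k)}\,\frac{1-ic_{k+n}^{(b)}}{1+ic_{k+n}^{(b)}} .$$ Let $d\varphi^{(b;k)}(x)=d\nu^{(b;k)}\big((x+i)/(x-i)\big)$, i.e. $\varphi^{(b;k)}(B)=\nu^{(b;k)}(\{(x+i)/(x-i):x\in B\})$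 for Borel sets $B\subset\mathbb R$. Then for all $n\ge0$ $$\int_{-\infty}^{\infty}x^j\,\frac{\mathcal P_n^{(k)}(b;x)}{(x^2+1)^n}\,d\varphi^{(b;k)}(x)=\gamma_n^{(b;k)}\delta_{n,j},\qquad j=0,1,\dots,n,$$ where $\gamma_0^{(b;k)}=1$ and $\gamma_n^{(b;k)}=(1-M_n^{(\lambda;k)})\gamma_{n-1}^{(b;k)}$ for $n\ge1$. Moreover, for all $n\ge0$ and all real $x$, $$\mathcal P_n^{(k+1)}(b;x)=\int_{-\infty}^{\infty}\frac{(1+x^2)^{n+1}\mathcal P_{n+1}^{(k)}(b;t)-(1+t^2)^{n+1}\mathcal P_{n+1}^{(k)}(b;x)}{M_1^{(\lambda;k)}\,(t-x)\,(1+t^2)^{n+1}}\,d\varphi^{(b;k)}(t),$$ where the integrand at $t=x$ is understood as its limit for $t\to x$. All these integrals converge absolutely. -/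

import Mathlib

open MeasureTheory Polynomial ComplexConjugate

namespace CRR

noncomputable section

/-- `c_n^{(b)} = η / (λ + n - 1)`, `n ≥ 1`, where `b = λ + i η`. -/
def c (b : ℂ) (n : ℕ) : ℝ := b.im / (b.re + n - 1)

/-- `d_n^{(λ)}`, `n ≥ 2`; that is, `d_{n+1} = n (n + 2λ - 1) / (4 (n + λ - 1) (n + λ))` for
`n ≥ 1`. -/
def d (lam : ℝ) (n : ℕ) : ℝ :=
  (1 / 4) * (((n : ℝ) - 1) * ((n : ℝ) + 2 * lam - 2)) / (((n : ℝ) + lam - 2) * ((n : ℝ) + lam - 1))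

/-- `P b k n` is the `k`-th associated complementary Romanovski-Routh polynomial of index `n`. -/
def P (b : ℂ) (k : ℕ) : ℕ → ℝ[X]
  | 0 => 1
  | 1 => X - C (c b (k + 1))
  | n + 2 => (X - C (c b (k + n + 2))) * P b k (n + 1)
      - C (d b.re (k + n + 2)) * (X ^ 2 + 1) * P b k n

/-- `g_1, g_2, …` is a parameter sequence of the positive chain sequence `a_2, a_3, …`.
The values `g 0`, `a 0`, `a 1` play no role. -/
def IsParameterSequence (a g : ℕ → ℝ) : Prop :=
  (0 ≤ g 1 ∧ g 1 < 1) ∧ (∀ n, 2 ≤ n → 0 < g n ∧ g n < 1) ∧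
    ∀ n, 1 ≤ n → a (n + 1) = (1 - g n) * g (n + 1)

/-- The maximal parameter sequence: it dominates every parameter sequence termwise. -/
def IsMaximalParameterSequence (a g : ℕ → ℝ) : Prop :=
  IsParameterSequence a g ∧
    ∀ g' : ℕ → ℝ, IsParameterSequence a g' → ∀ n, 1 ≤ n → g' n ≤ g n

/-- The explicit sequence `M_n^{(λ;k)}`, `n ≥ 1`. -/
def M (lam : ℝ) (k n : ℕ) : ℝ :=
  if lam ≤ 1 / 2 then (1 / 2) * (((k : ℝ) + n - 1) / (lam + k + n - 1))
  else (1 / 2) * ((2 * lam + k + n - 2) / (lam + k + n - 1))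

/-- `τ_0 = 1`, `τ_n = τ_{n-1} (1 - i c_{k+n}) / (1 + i c_{k+n})`. -/
def tau (b : ℂ) (k : ℕ) : ℕ → ℂ
  | 0 => 1
  | n + 1 => tau b k n *
      ((1 - Complex.I * (c b (k + (n + 1)) : ℂ)) / (1 + Complex.I * (c b (k + (n + 1)) : ℂ)))

/-- `beta b k n` is
`β_n = (1 / τ_n) (1 - 2 M_{n+1} - i c_{k+n+1}) / (1 - i c_{k+n+1})`, `n ≥ 0`. -/
def beta (b : ℂ) (k n : ℕ) : ℂ :=
  (1 / tau b k n) *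
    ((1 - 2 * (M b.re k (n + 1) : ℂ) - Complex.I * (c b (k + (n + 1)) : ℂ)) /
      (1 - Complex.I * (c b (k + (n + 1)) : ℂ)))

/-- `γ_0 = 1`, `γ_n = (1 - M_n) γ_{n-1}`. -/
def gam (lam : ℝ) (k : ℕ) : ℕ → ℝ
  | 0 => 1
  | n + 1 => (1 - M lam k (n + 1)) * gam lam k n

/-- `Φ` is the monic orthogonal polynomial of degree `n` for a measure `ν` on the unit circle. -/
def IsMonicOPUC (ν : Measure ℂ) (n : ℕ) (Φ : ℂ[X]) : Prop :=
  Φ.Monic ∧ Φ.natDegree = n ∧ ∀ j, j < n → ∫ z, conj (z ^ j) * Φ.eval z ∂ν = 0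

/-- `ν` is not supported on finitely many points, and `β_n = - conj (Φ_{n+1}(0))` for its monic
orthogonal polynomials `Φ_n`. -/
def HasVerblunskyCoeffs (ν : Measure ℂ) (β : ℕ → ℂ) : Prop :=
  (∀ s : Set ℂ, s.Finite → ν sᶜ ≠ 0) ∧
    ∃ Φ : ℕ → ℂ[X], (∀ n, IsMonicOPUC ν n (Φ n)) ∧ ∀ n, β n = -conj ((Φ (n + 1)).eval 0)

/-- The parametrization `x ↦ (x + i) / (x - i)` of the unit circle without the point `1`. -/
def cayley (x : ℝ) : ℂ := ((x : ℂ) + Complex.I) / ((x : ℂ) - Complex.I)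

/-- The measure `dφ(x) = dν((x + i) / (x - i))` on the real line: `φ(B) = ν(cayley '' B)`. -/
def lineMeasure (ν : Measure ℂ) : Measure ℝ := ν.comap cayley

/-- The quotient
`((1 + x²)^m P_m^{(k)}(t) - (1 + t²)^m P_m^{(k)}(x)) / (t - x)`, a polynomial in `t`.
The numerator vanishes at `t = x`, so `dslope` gives this quotient for `t ≠ x`, and its limit
(the derivative of the numerator) at `t = x`. -/
def divDiff (b : ℂ) (k m : ℕ) (x t : ℝ) : ℝ :=
  dslope (fun s : ℝ => (1 + x ^ 2) ^ m * (P b k m).eval s - (1 + s ^ 2) ^ m * (P b k m).eval x) x t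

end

end CRR

/-! The Cayley transform z = (x + i)/(x - i) turns the claim into one about para-orthogonal
polynomials on the circle: 2^n P_n(x) = (x - i)^n R_n(z) (`eval_P_eq`). Since d_{k+n+2} = (1 -
M_{n+1}) M_{n+2}, the three-term recurrence of R_n is equivalent to first-order relations which
match the Szegő recursion with coefficients `beta`, and (z - 1) R_n is a multiple of z Φ_n - τ_n
Φ_n^* (`sub_one_mul_eval_R`). Both terms are orthogonal to z, …, z^n, so the moments ∫ z^{-j} R_n
dν, 0 ≤ j ≤ n, all coincide; their value is 2^n γ_n (`integral_R`). Hence q ↦ ∫ z^{-n} q R_n dν, for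
deg q ≤ n, is 2^n γ_n times evaluation at 1. Up to a constant, x^j corresponds to q = (z + 1)^j (z -
1)^{n-j}, which vanishes at 1 unless j = n.

The transfer to the line loses no mass only if ν{1} = 0 (`measure_one_eq_zero`). The choice q = R_n
gives ν{1} W_n ≤ 1 with W_n the partial sums in Wall's criterion, and these diverge. Maximality of M
is proved separately, by a direct comparison with a harmonic series.

For the second-kind formula, the difference quotients obey the recurrence of the shifted polynomials
up to terms that integrate to zero by orthogonality (`integral_kernelQuot`). -/

namespace CRR

/-! ### The chain sequence and its maximal parameter sequence. -/

/-- The parameter range in which the associated CRR polynomials are considered. -/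
def Admissible (lam : ℝ) (k : ℕ) : Prop := (k = 0 ∧ 1 / 2 < lam) ∨ (1 ≤ k ∧ 0 < lam)

variable {lam : ℝ} {k : ℕ}

lemma Admissible.add_pos (h : Admissible lam k) : 0 < lam + k := by
  rcases h with ⟨rfl, h⟩ | ⟨hk, h⟩ <;> positivity

lemma Admissible.one_le (h : Admissible lam k) (hl : lam ≤ 1 / 2) : (1 : ℝ) ≤ k ∧ 0 < lam := by
  rcases h with ⟨_, h⟩ | ⟨hk, h⟩
  · linarith
  · exact ⟨by exact_mod_cast hk, h⟩

lemma Admissible.M_mem (h : Admissible lam k) (n : ℕ) :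
    0 < M lam k (n + 1) ∧ M lam k (n + 1) < 1 := by
  have h0 := h.add_pos
  have hn : (0 : ℝ) ≤ n := n.cast_nonneg
  have hk : (0 : ℝ) ≤ k := k.cast_nonneg
  have hden : (0 : ℝ) < lam + k + (n + 1 : ℕ) - 1 := by push_cast; linarith
  unfold M
  split_ifs with hl
  · obtain ⟨h1, h2⟩ := h.one_le hl
    have : (0 : ℝ) < (k : ℝ) + (n + 1 : ℕ) - 1 := by push_cast; linarith
    refine ⟨by positivity, ?_⟩
    rw [← mul_div_assoc, div_lt_one hden]; push_cast at *; linarith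
  · have : (0 : ℝ) < 2 * lam + (k : ℝ) + (n + 1 : ℕ) - 2 := by push_cast; linarith
    refine ⟨by positivity, ?_⟩
    rw [← mul_div_assoc, div_lt_one hden]; push_cast at *; linarith

lemma Admissible.d_eq (h : Admissible lam k) (n : ℕ) :
    d lam (k + n + 2) = (1 - M lam k (n + 1)) * M lam k (n + 2) := by
  have h0 := h.add_pos
  have hn : (0 : ℝ) ≤ n := n.cast_nonneg
  have h1 : lam + k + n ≠ 0 := by linarith
  have h2 : lam + k + n + 1 ≠ 0 := by linarith
  have e1 : (k : ℝ) + n + 2 + lam - 2 = lam + k + n := by ring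
  have e2 : (k : ℝ) + n + 2 + lam - 1 = lam + k + n + 1 := by ring
  have e3 : lam + k + ((n : ℝ) + 1) - 1 = lam + k + n := by ring
  have e4 : lam + k + ((n : ℝ) + 2) - 1 = lam + k + n + 1 := by ring
  unfold d M
  split_ifs <;> push_cast <;> rw [e1, e2, e3, e4] <;> field_simp <;> ring

/-- After clearing denominators the two sides are (2λ + k + n)/2 and (k + n + 1)/2; the case
distinction at λ = 1/2 in `M` puts the larger one on the right. This drives the proof of maximality.
-/
lemma Admissible.chain_ratio (h : Admissible lam k) (n : ℕ) :
    (1 - M lam k (n + 1)) * (lam + k + n) ≤ M lam k (n + 2) * (lam + k + n + 1) := by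
  have h0 := h.add_pos
  have hn : (0 : ℝ) ≤ n := n.cast_nonneg
  have h1 : lam + k + n ≠ 0 := by linarith
  have h2 : lam + k + n + 1 ≠ 0 := by linarith
  have e3 : lam + k + ((n : ℝ) + 1) - 1 = lam + k + n := by ring
  have e4 : lam + k + ((n : ℝ) + 2) - 1 = lam + k + n + 1 := by ring
  unfold M
  split_ifs with hl <;> push_cast <;> rw [e3, e4] <;> field_simp <;> linarith

/-- Read as M/(1 - M) ≥ (k + n)/(k + n + 1), a bound whose products telescope; it makes Wall's
series diverge. -/
lemma Admissible.wall_ratio (h : Admissible lam k) (n : ℕ) :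
    (1 - M lam k (n + 1)) * (k + n) ≤ M lam k (n + 1) * (k + n + 1) := by
  have h0 := h.add_pos
  have hn : (0 : ℝ) ≤ n := n.cast_nonneg
  have hk : (0 : ℝ) ≤ k := k.cast_nonneg
  have h1 : 0 < lam + k + n := by linarith
  have e3 : lam + k + ((n : ℝ) + 1) - 1 = lam + k + n := by ring
  unfold M
  split_ifs with hl <;> push_cast <;> rw [e3]
  · have : 1 / 2 * ((k + ((n : ℝ) + 1) - 1) / (lam + k + n)) * (k + n + 1)
      - (1 - 1 / 2 * ((k + ((n : ℝ) + 1) - 1) / (lam + k + n))) * (k + n)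
      = 1 / 2 * ((k + n) * (1 - 2 * lam)) / (lam + k + n) := by
      field_simp; ring
    have h2 : 0 ≤ 1 / 2 * ((k + n) * (1 - 2 * lam)) / (lam + k + n) := by
      have : 0 ≤ 1 - 2 * lam := by linarith
      positivity
    linarith
  · have : 1 / 2 * ((2 * lam + k + ((n : ℝ) + 1) - 2) / (lam + k + n)) * (k + n + 1)
      - (1 - 1 / 2 * ((2 * lam + k + ((n : ℝ) + 1) - 2) / (lam + k + n))) * (k + n)
      = 1 / 2 * ((k + n + 1) * (2 * lam - 1)) / (lam + k + n) := by
      field_simp; ring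
    have h2 : 0 ≤ 1 / 2 * ((k + n + 1) * (2 * lam - 1)) / (lam + k + n) := by
      have : 0 ≤ 2 * lam - 1 := by linarith
      positivity
    linarith

/-- Shifted harmonic series diverge. -/
lemma exists_lt_sum_inv_add (a B : ℝ) (ha : 0 < a) :
    ∃ m : ℕ, B < ∑ i ∈ Finset.range m, (a + i)⁻¹ := by
  obtain ⟨N, hN⟩ := exists_nat_ge a
  have hN0 : 0 < (N : ℝ) := ha.trans_le hN
  have h1 : ¬ Summable fun i : ℕ => (a + i)⁻¹ := by
    intro hs
    have h2 : Summable fun i : ℕ => (((i + N : ℕ) : ℝ))⁻¹ := by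
      refine Summable.of_nonneg_of_le (fun i => by positivity) (fun i => ?_) hs
      gcongr
      push_cast; linarith
    exact Real.not_summable_natCast_inv ((summable_nat_add_iff N).1 h2)
  have h3 := (not_summable_iff_tendsto_nat_atTop_of_nonneg
    (fun i : ℕ => (by positivity : (0 : ℝ) ≤ (a + i)⁻¹))).1 h1
  exact (h3.eventually_gt_atTop B).exists

lemma Admissible.isParameterSequence (h : Admissible lam k) :
    IsParameterSequence (fun n => d lam (k + n)) (M lam k) := by
  refine ⟨⟨(h.M_mem 0).1.le, (h.M_mem 0).2⟩, fun n hn => ?_, fun n hn => ?_⟩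
  · obtain ⟨m, rfl⟩ : ∃ m, n = m + 1 := ⟨n - 1, by omega⟩
    exact h.M_mem m
  · obtain ⟨m, rfl⟩ : ∃ m, n = m + 1 := ⟨n - 1, by omega⟩
    exact h.d_eq m

lemma Admissible.isMaximalParameterSequence (h : Admissible lam k) :
    IsMaximalParameterSequence (fun n => d lam (k + n)) (M lam k) := by
  refine ⟨h.isParameterSequence, fun g hg n hn => ?_⟩
  by_contra! hlt
  obtain ⟨N, rfl⟩ : ∃ m, n = m + 1 := ⟨n - 1, by omega⟩
  have hg1 : ∀ m, g (m + 1) < 1 := by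
    rintro (_ | m)
    · exact hg.1.2
    · exact (hg.2.1 (m + 2) (by omega)).2
  set A : ℕ → ℝ := fun m => lam + k + (N + m : ℕ) with hA
  set e : ℕ → ℝ := fun m => g (N + m + 1) - M lam k (N + m + 1) with he
  have hApos : ∀ m, 0 < A m := fun m => by
    have := h.add_pos
    simp only [hA]; positivity
  -- An excess e_m of g over M propagates: both sequences factor the same d, so e_{m+1} (1 - g) =
  -- e_m M. With the weights A_m, `chain_ratio` makes the positive quantity 1/(A_m e_m) drop by at
  -- least 1/A_m at each step, which the divergence of ∑ 1/A_m forbids.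
  have hstep : ∀ m, 0 < e m → 0 < e (m + 1) ∧
      (A (m + 1) * e (m + 1))⁻¹ ≤ (A m * e m)⁻¹ - (A m)⁻¹ := by
    intro m hm
    have h1 := hg1 (N + m)
    have h2 := h.M_mem (N + m)
    have h3 := h.M_mem (N + m + 1)
    have hd := h.d_eq (N + m)
    have hd' : d lam (k + (N + m + 1 + 1)) = (1 - g (N + m + 1)) * g (N + m + 1 + 1) :=
      hg.2.2 (N + m + 1) (by omega)
    have hr := h.chain_ratio (N + m)
    have hAm := hApos m
    have eA : A (m + 1) = A m + 1 := by simp only [hA]; push_cast; ring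
    have eA' : lam + k + ((N + m : ℕ) : ℝ) = A m := rfl
    rw [eA'] at hr
    have key : e (m + 1) * (1 - g (N + m + 1)) = e m * M lam k (N + m + 2) := by
      have : (1 - M lam k (N + m + 1)) * M lam k (N + m + 2)
          = (1 - g (N + m + 1)) * g (N + m + 2) := by
        rw [← hd, ← hd']; rfl
      simp only [he]
      rw [show N + (m + 1) + 1 = N + m + 2 by ring]
      linear_combination -this
    have hpos : 0 < e (m + 1) := by
      have : 0 < e (m + 1) * (1 - g (N + m + 1)) := by
        rw [key]; exact mul_pos hm h3.1
      exact pos_of_mul_pos_left this (by linarith)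
    refine ⟨hpos, ?_⟩
    have hq : (A (m + 1) * e (m + 1))⁻¹
        = (1 - g (N + m + 1)) / (e m * (M lam k (N + m + 2) * (A m + 1))) := by
      rw [eA, ← mul_assoc, ← key]
      have : 1 - g (N + m + 1) ≠ 0 := by linarith
      have : A m + 1 ≠ 0 := by linarith
      field_simp
    have hM : 0 < 1 - M lam k (N + m + 1) := by linarith
    calc (A (m + 1) * e (m + 1))⁻¹
        = (1 - g (N + m + 1)) / (e m * (M lam k (N + m + 2) * (A m + 1))) := hq
      _ ≤ (1 - g (N + m + 1)) / (e m * ((1 - M lam k (N + m + 1)) * A m)) := by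
          gcongr
      _ ≤ (A m * e m)⁻¹ - (A m)⁻¹ := by
          have : g (N + m + 1) = M lam k (N + m + 1) + e m := by simp only [he]; ring
          rw [this]
          have h4 : (A m * e m)⁻¹ - (A m)⁻¹
            - (1 - (M lam k (N + m + 1) + e m)) / (e m * ((1 - M lam k (N + m + 1)) * A m))
            = M lam k (N + m + 1) / ((1 - M lam k (N + m + 1)) * A m) := by
            have := hM.ne'
            field_simp
            ring
          have h5 : 0 ≤ M lam k (N + m + 1) / ((1 - M lam k (N + m + 1)) * A m) :=
            div_nonneg h2.1.le (by positivity)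
          linarith
  have hsum : ∀ m, 0 < e m ∧
      (A m * e m)⁻¹ ≤ (A 0 * e 0)⁻¹ - ∑ i ∈ Finset.range m, (A i)⁻¹ := by
    intro m
    induction m with
    | zero => exact ⟨by simp only [he]; simpa using hlt, by simp⟩
    | succ m ih =>
      obtain ⟨h1, h2⟩ := hstep m ih.1
      refine ⟨h1, ?_⟩
      rw [Finset.sum_range_succ]
      linarith [ih.2]
  obtain ⟨m, hm⟩ := exists_lt_sum_inv_add (lam + k + N) (A 0 * e 0)⁻¹
    (by have := h.add_pos; positivity)
  have h1 := hsum m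
  have h2 : 0 < (A m * e m)⁻¹ := inv_pos.2 (mul_pos (hApos m) h1.1)
  have h3 : ∑ i ∈ Finset.range m, (A i)⁻¹ = ∑ i ∈ Finset.range m, (lam + k + N + (i : ℝ))⁻¹ := by
    refine Finset.sum_congr rfl fun i _ => ?_
    simp only [hA]; push_cast; ring_nf
  linarith [h1.2]

end CRR

namespace CRR

/-! ### Measures on the unit circle and the Szegő recursion -/

section Circle

variable {ν : Measure ℂ}

lemma ae_norm_eq_one (hν : ν (Metric.sphere (0 : ℂ) 1)ᶜ = 0) : ∀ᵐ z ∂ν, ‖z‖ = 1 := by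
  filter_upwards [compl_mem_ae_iff.2 hν] with z hz
  simpa using hz

lemma integrable_of_continuous [IsFiniteMeasure ν] (hν : ν (Metric.sphere (0 : ℂ) 1)ᶜ = 0)
    {f : ℂ → ℂ} (hf : Continuous f) : Integrable f ν := by
  obtain ⟨B, hB⟩ := (isCompact_sphere (0 : ℂ) 1).exists_bound_of_continuousOn hf.continuousOn
  refine Integrable.of_bound hf.aestronglyMeasurable B ?_
  filter_upwards [ae_norm_eq_one hν] with z hz
  exact hB z (by simpa using hz)

lemma conj_mul_self_of_norm {z : ℂ} (hz : ‖z‖ = 1) : conj z * z = 1 := by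
  rw [mul_comm, Complex.mul_conj, Complex.normSq_eq_norm_sq, hz]; simp

lemma conj_pow_mul_pow {z : ℂ} (hz : ‖z‖ = 1) {i n : ℕ} (h : i ≤ n) :
    conj z ^ n * z ^ i = conj z ^ (n - i) := by
  obtain ⟨m, rfl⟩ := Nat.exists_eq_add_of_le h
  rw [Nat.add_sub_cancel_left, add_comm, pow_add, mul_assoc, ← mul_pow, conj_mul_self_of_norm hz,
    one_pow, mul_one]

/-- A polynomial that vanishes almost everywhere for a measure of infinite support is zero. -/
lemma eq_zero_of_ae_eval_eq_zero (hs : ∀ s : Set ℂ, s.Finite → ν sᶜ ≠ 0) {D : ℂ[X]}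
    (h : ∀ᵐ z ∂ν, D.eval z = 0) : D = 0 := by
  by_contra hD
  refine hs {z | D.IsRoot z} (D.finite_setOfPred_isRoot hD) ?_
  exact h

variable [IsFiniteMeasure ν]

/-- If `D` is orthogonal to every power that occurs in it, then `D = 0`. -/
lemma eq_zero_of_orthogonal (hν : ν (Metric.sphere (0 : ℂ) 1)ᶜ = 0)
    (hs : ∀ s : Set ℂ, s.Finite → ν sᶜ ≠ 0) {D : ℂ[X]}
    (h : ∀ j ∈ D.support, ∫ z, conj (z ^ j) * D.eval z ∂ν = 0) : D = 0 := by
  apply eq_zero_of_ae_eval_eq_zero hs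
  have h0 : ∫ z, conj (D.eval z) * D.eval z ∂ν = 0 := by
    have : ∀ z : ℂ, conj (D.eval z) * D.eval z
        = ∑ j ∈ D.support, conj (D.coeff j) * (conj (z ^ j) * D.eval z) := by
      intro z
      have h1 : conj (D.eval z) = ∑ j ∈ D.support, conj (D.coeff j) * conj (z ^ j) := by
        rw [eval_eq_sum, Polynomial.sum_def, map_sum]
        simp only [map_mul]
      rw [h1, Finset.sum_mul]
      exact Finset.sum_congr rfl fun j _ => mul_assoc _ _ _
    simp_rw [this]
    rw [integral_finsetSum]
    · refine Finset.sum_eq_zero fun j hj => ?_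
      rw [integral_const_mul, h j hj, mul_zero]
    · intro j _
      exact integrable_of_continuous hν (by fun_prop)
  have h1 : ∫ z, ‖D.eval z‖ ^ 2 ∂ν = 0 := by
    have h2 : ∀ z : ℂ, conj (D.eval z) * D.eval z = ((‖D.eval z‖ ^ 2 : ℝ) : ℂ) := fun z => by
      rw [mul_comm, Complex.mul_conj, Complex.normSq_eq_norm_sq]
    simp_rw [h2] at h0
    exact Complex.ofReal_eq_zero.1 (integral_ofReal.symm.trans h0)
  have hi : Integrable (fun z => ‖D.eval z‖ ^ 2) ν := by
    have : Integrable (fun z : ℂ => D.eval z ^ 2) ν :=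
      integrable_of_continuous hν (by fun_prop)
    simpa [norm_pow] using this.norm
  rw [integral_eq_zero_iff_of_nonneg (fun z => by positivity) hi] at h1
  filter_upwards [h1] with z hz
  simpa using hz

end Circle

/-- The pairs `(Φ_n, Φ_n^*)` generated by the Szegő recursion with coefficients `β`. -/
noncomputable def szego (β : ℕ → ℂ) : ℕ → ℂ[X] × ℂ[X]
  | 0 => (1, 1)
  | n + 1 => (X * (szego β n).1 - C (conj (β n)) * (szego β n).2,
      (szego β n).2 - C (β n) * (X * (szego β n).1))

lemma szego_natDegree (β : ℕ → ℂ) (n : ℕ) :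
    (szego β n).1.natDegree ≤ n ∧ (szego β n).2.natDegree ≤ n := by
  induction n with
  | zero => simp [szego]
  | succ n ih =>
    have h1 : (X * (szego β n).1).natDegree ≤ n + 1 :=
      natDegree_mul_le.trans (by rw [natDegree_X]; omega)
    constructor
    · exact (natDegree_sub_le _ _).trans (max_le h1 ((natDegree_C_mul_le _ _).trans (by omega)))
    · exact (natDegree_sub_le _ _).trans (max_le (by omega) ((natDegree_C_mul_le _ _).trans h1))

lemma szego_snd_coeff_zero (β : ℕ → ℂ) (n : ℕ) : (szego β n).2.coeff 0 = 1 := by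
  induction n with
  | zero => simp [szego]
  | succ n ih => simp [szego, ih]

lemma szego_snd_eval (β : ℕ → ℂ) {z : ℂ} (hz : ‖z‖ = 1) (n : ℕ) :
    (szego β n).2.eval z = z ^ n * conj ((szego β n).1.eval z) := by
  have hz1 := conj_mul_self_of_norm hz
  induction n with
  | zero => simp [szego]
  | succ n ih =>
    have h1 : z ^ n * conj ((szego β n).2.eval z) = (szego β n).1.eval z := by
      rw [ih, map_mul, map_pow, Complex.conj_conj, ← mul_assoc, ← mul_pow, mul_comm z, hz1,
        one_pow, one_mul]
    simp only [szego, eval_sub, eval_mul, eval_X, eval_C, map_sub, map_mul, Complex.conj_conj]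
    rw [pow_succ]
    linear_combination ih + β n * z * h1 - z ^ n * conj ((szego β n).1.eval z) * hz1

section Orthogonality

variable {ν : Measure ℂ}

/-- On the circle Φ_n^* = z^n conj Φ_n, so pairing Φ_n^* with z^j is the conjugate of pairing Φ_n
with z^{n-j}, and n - j < n exactly because j ≥ 1. -/
lemma integral_szego_snd (hν : ν (Metric.sphere (0 : ℂ) 1)ᶜ = 0) {β : ℕ → ℂ} {n : ℕ}
    (h : ∀ j < n, ∫ z, conj (z ^ j) * (szego β n).1.eval z ∂ν = 0) {j : ℕ} (h1 : 1 ≤ j)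
    (hj : j ≤ n) : ∫ z, conj (z ^ j) * (szego β n).2.eval z ∂ν = 0 := by
  have h2 : ∫ z, conj (z ^ j) * (szego β n).2.eval z ∂ν
      = ∫ z, conj (conj (z ^ (n - j)) * (szego β n).1.eval z) ∂ν := by
    refine integral_congr_ae ?_
    filter_upwards [ae_norm_eq_one hν] with z hz
    rw [szego_snd_eval β hz, map_mul, Complex.conj_conj, ← mul_assoc]
    congr 1
    have := congrArg conj (conj_pow_mul_pow hz hj)
    simpa [mul_comm] using this
  rw [h2, integral_conj, h _ (by omega), map_zero]

/-- The monic orthogonal polynomials satisfy the Szegő recursion. -/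
lemma eq_szego [IsFiniteMeasure ν] (hν : ν (Metric.sphere (0 : ℂ) 1)ᶜ = 0)
    (hs : ∀ s : Set ℂ, s.Finite → ν sᶜ ≠ 0) {β : ℕ → ℂ} {Φ : ℕ → ℂ[X]}
    (hΦ : ∀ n, IsMonicOPUC ν n (Φ n)) (hβ : ∀ n, β n = -conj ((Φ (n + 1)).eval 0)) (n : ℕ) :
    Φ n = (szego β n).1 := by
  induction n with
  | zero =>
    have := hΦ 0
    simpa [szego] using eq_one_of_monic_natDegree_zero this.1 this.2.1
  | succ n ih =>
    rw [← sub_eq_zero]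
    have horth : ∀ j < n, ∫ z, conj (z ^ j) * (szego β n).1.eval z ∂ν = 0 := by
      rw [← ih]; exact (hΦ n).2.2
    -- The leading terms of Φ_{n+1} and z Φ_n cancel, and the choice of β_n cancels the constant
    -- term, so only z, …, z^n can occur in D. All three of Φ_{n+1}, z Φ_n and Φ_n^* are orthogonal
    -- to these powers.
    set D := Φ (n + 1) - (szego β (n + 1)).1 with hD
    have hmon := hΦ n
    have hmon' := hΦ (n + 1)
    have hnd : D.natDegree ≤ n := by
      have h1 : (Φ (n + 1) - X * Φ n).natDegree ≤ n := by
        have hX : (X * Φ n).natDegree = n + 1 := by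
          rw [natDegree_X_mul hmon.1.ne_zero, hmon.2.1]
        refine natDegree_le_of_degree_le (Order.le_of_lt_succ ?_)
        have : (Φ (n + 1) - X * Φ n).degree < (Φ (n + 1)).degree := by
          apply degree_sub_lt_left
          · rw [degree_eq_natDegree hmon'.1.ne_zero,
              degree_eq_natDegree (mul_ne_zero X_ne_zero hmon.1.ne_zero), hX, hmon'.2.1]
          · exact hmon'.1.ne_zero
          · rw [hmon'.1.leadingCoeff, (monic_X.mul hmon.1).leadingCoeff]
        rw [degree_eq_natDegree hmon'.1.ne_zero, hmon'.2.1] at this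
        exact this
      have h2 : D = (Φ (n + 1) - X * Φ n) + C (conj (β n)) * (szego β n).2 := by
        rw [hD, szego, ← ih]; ring
      rw [h2]
      exact (natDegree_add_le _ _).trans (max_le h1
        ((natDegree_C_mul_le _ _).trans (szego_natDegree β n).2))
    have hc0 : D.coeff 0 = 0 := by
      rw [hD, coeff_sub, szego]
      simp [szego_snd_coeff_zero, hβ, coeff_zero_eq_eval_zero (Φ (n + 1))]
    apply eq_zero_of_orthogonal hν hs
    intro j hj
    have hj0 : j ≠ 0 := by
      rintro rfl
      exact (mem_support_iff.1 hj) hc0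
    have hjn : j ≤ n := (le_natDegree_of_mem_supp j hj).trans hnd
    have hi : ∀ p : ℂ[X], Integrable (fun z => conj (z ^ j) * p.eval z) ν := fun p =>
      integrable_of_continuous hν (by fun_prop)
    have e1 : ∫ z, conj (z ^ j) * (X * (szego β n).1).eval z ∂ν = 0 := by
      rw [← horth (j - 1) (by omega)]
      refine integral_congr_ae ?_
      filter_upwards [ae_norm_eq_one hν] with z hz
      have := conj_mul_self_of_norm hz
      obtain ⟨i, rfl⟩ : ∃ i, j = i + 1 := ⟨j - 1, by omega⟩
      simp only [eval_mul, eval_X, map_pow, Nat.add_sub_cancel]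
      rw [pow_succ]
      linear_combination conj z ^ i * (szego β n).1.eval z * this
    have e2 := integral_szego_snd hν horth (by omega : 1 ≤ j) hjn
    have e3 := hmon'.2.2 j (by omega)
    have : ∀ z : ℂ, conj (z ^ j) * D.eval z = conj (z ^ j) * (Φ (n + 1)).eval z
        - conj (z ^ j) * (X * (szego β n).1).eval z
        + conj (β n) * (conj (z ^ j) * (szego β n).2.eval z) := by
      intro z
      rw [hD, szego]
      simp only [eval_sub, eval_mul, eval_C]
      ring
    simp_rw [this]
    rw [integral_add (by exact (hi _).sub (hi _)) ((hi _).const_mul _), integral_sub (hi _) (hi _),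
      integral_const_mul, e1, e2, e3]
    simp

end Orthogonality

end CRR

namespace CRR

/-! ### The three-term recurrence on the circle -/

variable (b : ℂ) (k : ℕ)

lemma one_add_I_mul_ne_zero (x : ℝ) : 1 + Complex.I * (x : ℂ) ≠ 0 := by
  intro h
  simpa using congrArg Complex.re h

lemma one_sub_I_mul_ne_zero (x : ℝ) : 1 - Complex.I * (x : ℂ) ≠ 0 := by
  intro h
  simpa using congrArg Complex.re h

lemma tau_ne_zero (n : ℕ) : tau b k n ≠ 0 := by
  induction n with
  | zero => simp [tau]
  | succ n ih =>
    exact mul_ne_zero ih (div_ne_zero (one_sub_I_mul_ne_zero _) (one_add_I_mul_ne_zero _))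

lemma tau_mul_conj (n : ℕ) : tau b k n * conj (tau b k n) = 1 := by
  induction n with
  | zero => simp [tau]
  | succ n ih =>
    have h1 := one_sub_I_mul_ne_zero (c b (k + (n + 1)))
    have h2 := one_add_I_mul_ne_zero (c b (k + (n + 1)))
    simp only [tau, map_mul, map_div₀, map_sub, map_add, map_one, Complex.conj_I,
      Complex.conj_ofReal, neg_mul, sub_neg_eq_add]
    rw [← sub_eq_add_neg]
    rw [mul_mul_mul_comm, ih]
    field_simp

lemma beta_mul_tau (n : ℕ) :
    beta b k n * tau b k n * (1 - Complex.I * (c b (k + (n + 1)) : ℂ))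
      = 1 - 2 * (M b.re k (n + 1) : ℂ) - Complex.I * (c b (k + (n + 1)) : ℂ) := by
  have h1 := one_sub_I_mul_ne_zero (c b (k + (n + 1)))
  have h2 := tau_ne_zero b k n
  unfold beta
  field_simp

lemma conj_beta_mul (n : ℕ) :
    conj (beta b k n) * (1 + Complex.I * (c b (k + (n + 1)) : ℂ))
      = tau b k n *
        (1 - 2 * (M b.re k (n + 1) : ℂ) + Complex.I * (c b (k + (n + 1)) : ℂ)) := by
  have h := congrArg conj (beta_mul_tau b k n)
  simp only [map_mul, map_sub, map_one, map_ofNat, Complex.conj_I, Complex.conj_ofReal, neg_mul,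
    sub_neg_eq_add] at h
  have h2 := tau_mul_conj b k n
  linear_combination tau b k n * h
    - conj (beta b k n) * (1 + Complex.I * (c b (k + (n + 1)) : ℂ)) * h2

/-- The para-orthogonal polynomials obtained from `P b k n` by the Cayley transform. -/
noncomputable def R : ℕ → ℂ[X]
  | 0 => 1
  | 1 => C (1 + Complex.I * (c b (k + 1) : ℂ)) * X + C (1 - Complex.I * (c b (k + 1) : ℂ))
  | n + 2 => (C (1 + Complex.I * (c b (k + n + 2) : ℂ)) * X
        + C (1 - Complex.I * (c b (k + n + 2) : ℂ))) * R (n + 1)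
      - C (4 * (d b.re (k + n + 2) : ℂ)) * X * R n

/-- The leading coefficient of `R b k n`. -/
noncomputable def leadR : ℕ → ℂ
  | 0 => 1
  | n + 1 => leadR n * (1 + Complex.I * (c b (k + (n + 1)) : ℂ))

lemma natDegree_R (n : ℕ) : (R b k n).natDegree ≤ n := by
  have hlin : ∀ u v : ℂ, (C u * X + C v).natDegree ≤ 1 := fun u v => natDegree_linear_le
  induction n using Nat.twoStepInduction with
  | zero => simp [R]
  | one => exact hlin _ _
  | more n ih1 ih2 =>
    rw [R]
    refine (natDegree_sub_le _ _).trans (max_le (natDegree_mul_le.trans ?_)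
      (natDegree_mul_le.trans ?_))
    · have := hlin (1 + Complex.I * (c b (k + n + 2) : ℂ)) (1 - Complex.I * (c b (k + n + 2) : ℂ))
      omega
    · have := natDegree_C_mul_le (4 * (d b.re (k + n + 2) : ℂ)) X
      rw [natDegree_X] at this
      omega

/-- Self-reciprocity, the circle counterpart of the real coefficients of `P`; later it turns z^{-n}
R_n² into |R_n|². -/
lemma conj_eval_R {z : ℂ} (hz : ‖z‖ = 1) (n : ℕ) :
    conj ((R b k n).eval z) = conj z ^ n * (R b k n).eval z := by
  have h := conj_mul_self_of_norm hz
  induction n using Nat.twoStepInduction with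
  | zero => simp [R]
  | one =>
    simp only [R, eval_add, eval_mul, eval_C, eval_X]
    simp only [map_add, map_mul, map_sub, map_one,
      Complex.conj_I, Complex.conj_ofReal]
    linear_combination -(1 + Complex.I * (c b (k + 1) : ℂ)) * h
  | more n ih1 ih2 =>
    simp only [R, eval_add, eval_sub, eval_mul, eval_C, eval_X]
    simp only [map_add, map_mul, map_sub, map_one,
      Complex.conj_I, Complex.conj_ofReal, map_ofNat, ih1, ih2]
    rw [pow_succ, pow_succ]
    linear_combination (-(1 + Complex.I * (c b (k + n + 2) : ℂ)) * conj z ^ n * conj z *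
      (R b k (n + 1)).eval z + 4 * (d b.re (k + n + 2) : ℂ) * conj z ^ n * conj z *
      (R b k n).eval z) * h

variable {b k}

/-- Eliminates Φ_n from the Szegő step for Φ_{n+1}^*. The relation `hA` is a hypothesis because this
is needed inside the induction that establishes it. -/
lemma leadR_tau_szego_succ {z : ℂ} {n : ℕ}
    (hA : (z - 1) * (R b k n).eval z = leadR b k n *
      (z * (szego (beta b k) n).1.eval z - tau b k n * (szego (beta b k) n).2.eval z)) :
    leadR b k (n + 1) * tau b k (n + 1) * (szego (beta b k) (n + 1)).2.eval z
      = 2 * (M b.re k (n + 1) : ℂ) *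
          (leadR b k n * tau b k n * (szego (beta b k) n).2.eval z)
        - (1 - 2 * (M b.re k (n + 1) : ℂ) - Complex.I * (c b (k + (n + 1)) : ℂ)) *
          ((z - 1) * (R b k n).eval z) := by
  have hb := beta_mul_tau b k n
  have h2 := one_add_I_mul_ne_zero (c b (k + (n + 1)))
  have e : leadR b k (n + 1) * tau b k (n + 1)
      = leadR b k n * tau b k n * (1 - Complex.I * (c b (k + (n + 1)) : ℂ)) := by
    simp only [leadR, tau]
    field_simp
  rw [e, hA, ← hb]
  simp only [szego, eval_sub, eval_mul, eval_C, eval_X]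
  linear_combination (-leadR b k n * tau b k n * (szego (beta b k) n).2.eval z) * hb

/-- `R b k n` is a multiple of `(z Φ_n - τ_n Φ_n^*) / (z - 1)`. -/
lemma sub_one_mul_eval_R (h : Admissible b.re k) (z : ℂ) (n : ℕ) :
    (z - 1) * (R b k n).eval z = leadR b k n *
      (z * (szego (beta b k) n).1.eval z - tau b k n * (szego (beta b k) n).2.eval z) ∧
    (R b k (n + 1)).eval z = ((1 + Complex.I * (c b (k + (n + 1)) : ℂ)) * z
        + (1 - Complex.I * (c b (k + (n + 1)) : ℂ)) - 2 * (M b.re k (n + 1) : ℂ)) *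
          (R b k n).eval z
      + 2 * (M b.re k (n + 1) : ℂ) *
          (leadR b k n * tau b k n * (szego (beta b k) n).2.eval z) := by
  -- The two relations need each other: the second, of first order in (R_n, Φ_n^*), replaces the
  -- three-term recurrence. Its base case holds for any value of M_1, and the step uses only the
  -- factorization of d.
  induction n with
  | zero =>
    constructor
    · simp [R, leadR, tau, szego]
    · simp [R, leadR, tau, szego]
  | succ n ih =>
    obtain ⟨hA, hE⟩ := ih
    have hV := leadR_tau_szego_succ hA
    have hd : (d b.re (k + n + 2) : ℂ)
        = (1 - (M b.re k (n + 1) : ℂ)) * (M b.re k (n + 2) : ℂ) := by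
      rw [h.d_eq n]; push_cast; ring
    constructor
    · have hb := beta_mul_tau b k n
      have hcb := conj_beta_mul b k n
      have h2 := one_add_I_mul_ne_zero (c b (k + (n + 1)))
      have ht : tau b k (n + 1) * (1 + Complex.I * (c b (k + (n + 1)) : ℂ))
          = tau b k n * (1 - Complex.I * (c b (k + (n + 1)) : ℂ)) := by
        simp only [tau]; field_simp
      rw [mul_sub, ← mul_assoc (leadR b k (n + 1)) (tau b k (n + 1)), hV, hE]
      simp only [szego, leadR, eval_sub, eval_mul, eval_C, eval_X]
      generalize (szego (beta b k) n).1.eval z = p at *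
      generalize (szego (beta b k) n).2.eval z = q at *
      generalize (R b k n).eval z = r at *
      linear_combination (z * (1 + Complex.I * (c b (k + (n + 1)) : ℂ))) * hA
        + leadR b k n * z * q * hcb
    · have e : k + n + 2 = k + (n + 1 + 1) := by ring
      rw [hV, R]
      simp only [eval_add, eval_sub, eval_mul, eval_C, eval_X, hd]
      rw [e]
      linear_combination (2 * (M b.re k (n + 2) : ℂ)) * hE

lemma leadR_tau_szego_snd (h : Admissible b.re k) (z : ℂ) (n : ℕ) :
    leadR b k (n + 1) * tau b k (n + 1) * (szego (beta b k) (n + 1)).2.eval z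
      = (R b k (n + 1)).eval z - 2 * (1 - (M b.re k (n + 1) : ℂ)) * (z * (R b k n).eval z) := by
  obtain ⟨hA, hE⟩ := sub_one_mul_eval_R h z n
  rw [leadR_tau_szego_succ hA, hE]
  ring

/-! ### Growth at the point `1` -/

/-- The products `∏ M_j / (1 - M_j)`, `1 ≤ j ≤ n + 1`. -/
noncomputable def wallProd (lam : ℝ) (k : ℕ) : ℕ → ℝ
  | 0 => M lam k 1 / (1 - M lam k 1)
  | n + 1 => wallProd lam k n * (M lam k (n + 2) / (1 - M lam k (n + 2)))

/-- The partial sums of Wall's criterion for maximality of a parameter sequence. -/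
noncomputable def wallSum (lam : ℝ) (k n : ℕ) : ℝ := 1 + ∑ i ∈ Finset.range n, wallProd lam k i

section Growth

variable {lam : ℝ} {k : ℕ}

/-- By `wall_ratio` the product (k + 1 + n) `wallProd` is nondecreasing in n, so `wallProd` decays
no faster than a harmonic term. -/
lemma Admissible.wallProd_lower (h : Admissible lam k) (n : ℕ) :
    0 < wallProd lam k n ∧ (k + 1) * wallProd lam k 0 ≤ (k + 1 + n) * wallProd lam k n := by
  induction n with
  | zero =>
    have := h.M_mem 0
    exact ⟨div_pos this.1 (by linarith), by simp⟩
  | succ n ih =>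
    have h1 := h.M_mem (n + 1)
    have h3 : 0 < 1 - M lam k (n + 2) := by linarith
    refine ⟨mul_pos ih.1 (div_pos h1.1 h3), ih.2.trans ?_⟩
    have h2 := h.wall_ratio (n + 1)
    have h4 : (k + 1 + n : ℝ) ≤ (k + 1 + n + 1) * (M lam k (n + 2) / (1 - M lam k (n + 2))) := by
      rw [← mul_div_assoc, le_div_iff₀ h3]
      push_cast at h2
      linarith
    calc (k + 1 + n : ℝ) * wallProd lam k n
        ≤ (k + 1 + n + 1) * (M lam k (n + 2) / (1 - M lam k (n + 2))) * wallProd lam k n :=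
          mul_le_mul_of_nonneg_right h4 ih.1.le
      _ = (k + 1 + (n + 1 : ℕ)) * wallProd lam k (n + 1) := by
          simp only [wallProd]; push_cast; ring

lemma Admissible.exists_lt_wallSum (h : Admissible lam k) (B : ℝ) :
    ∃ n, B < wallSum lam k n := by
  have h0 : 0 < (k + 1) * wallProd lam k 0 := mul_pos (by positivity) (h.wallProd_lower 0).1
  obtain ⟨n, hn⟩ := exists_lt_sum_inv_add ((k : ℝ) + 1) (B / ((k + 1) * wallProd lam k 0))
    (by positivity)
  refine ⟨n, ?_⟩
  rw [div_lt_iff₀ h0, Finset.sum_mul] at hn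
  have : ∑ i ∈ Finset.range n, ((k : ℝ) + 1 + i)⁻¹ * ((k + 1) * wallProd lam k 0)
      ≤ ∑ i ∈ Finset.range n, wallProd lam k i := by
    refine Finset.sum_le_sum fun i _ => ?_
    rw [inv_mul_le_iff₀ (by positivity)]
    exact (h.wallProd_lower i).2
  unfold wallSum
  linarith

lemma Admissible.gam_pos (h : Admissible lam k) (n : ℕ) : 0 < gam lam k n := by
  induction n with
  | zero => simp [gam]
  | succ n ih => exact mul_pos (by linarith [h.M_mem n]) ih

end Growth

/-- At z = 1 the terms ± i c cancel, leaving R_{n+2}(1) = 2 R_{n+1}(1) - 4 d R_n(1); the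
factorization of d solves this in closed form. -/
lemma eval_one_R (h : Admissible b.re k) (n : ℕ) :
    (R b k n).eval 1 = ((2 ^ n * (gam b.re k n * wallSum b.re k n) : ℝ) : ℂ) := by
  induction n using Nat.twoStepInduction with
  | zero => simp [R, gam, wallSum]
  | one =>
    have h1 : 1 - M b.re k 1 ≠ 0 := by linarith [h.M_mem 0]
    have : (2 : ℝ) ^ 1 * (gam b.re k 1 * wallSum b.re k 1) = 2 := by
      simp only [gam, wallSum, wallProd, Finset.sum_range_one]
      field_simp
      ring
    rw [this]
    simp only [R, eval_add, eval_mul, eval_C, eval_X]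
    push_cast; ring
  | more n ih1 ih2 =>
    have h2 : 1 - M b.re k (n + 2) ≠ 0 := by linarith [h.M_mem (n + 1)]
    have key : (2 : ℝ) ^ (n + 2) * (gam b.re k (n + 2) * wallSum b.re k (n + 2))
        = 2 * (2 ^ (n + 1) * (gam b.re k (n + 1) * wallSum b.re k (n + 1)))
          - 4 * d b.re (k + n + 2) * (2 ^ n * (gam b.re k n * wallSum b.re k n)) := by
      have e1 : wallSum b.re k (n + 1) = wallSum b.re k n + wallProd b.re k n := by
        simp only [wallSum, Finset.sum_range_succ]; ring
      have e2 : wallSum b.re k (n + 2) = wallSum b.re k (n + 1) + wallProd b.re k (n + 1) := by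
        simp only [wallSum, Finset.sum_range_succ]; ring
      rw [e2, e1, h.d_eq n]
      simp only [gam, wallProd]
      field_simp
      ring
    rw [key, R]
    simp only [eval_add, eval_sub, eval_mul, eval_C, eval_X, ih1, ih2]
    push_cast; ring

end CRR

namespace CRR

/-! ### Orthogonality on the circle -/

section CircleOrthogonality

variable {b : ℂ} {k : ℕ} {ν : Measure ℂ}

lemma conj_pow_succ_mul {z : ℂ} (hz : ‖z‖ = 1) (j : ℕ) (w : ℂ) :
    conj (z ^ (j + 1)) * (z * w) = conj (z ^ j) * w := by
  have := conj_mul_self_of_norm hz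
  rw [map_pow, map_pow, pow_succ]
  linear_combination conj z ^ j * w * this

lemma integral_szego_fst [IsFiniteMeasure ν] (hν : ν (Metric.sphere (0 : ℂ) 1)ᶜ = 0)
    {β : ℕ → ℂ} (hV : HasVerblunskyCoeffs ν β) {n j : ℕ} (hj : j < n) :
    ∫ z, conj (z ^ j) * (szego β n).1.eval z ∂ν = 0 := by
  obtain ⟨hs, Φ, hΦ, hβ⟩ := hV
  rw [← eq_szego hν hs hΦ hβ n]
  exact (hΦ n).2.2 j hj

lemma integral_sub_one_mul_R [IsFiniteMeasure ν] (h : Admissible b.re k)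
    (hν : ν (Metric.sphere (0 : ℂ) 1)ᶜ = 0) (hV : HasVerblunskyCoeffs ν (beta b k)) {n j : ℕ}
    (hj : j < n) : ∫ z, conj (z ^ (j + 1)) * ((z - 1) * (R b k n).eval z) ∂ν = 0 := by
  have h1 : ∫ z, conj (z ^ (j + 1)) * (z * (szego (beta b k) n).1.eval z) ∂ν = 0 := by
    rw [← integral_szego_fst hν hV hj]
    refine integral_congr_ae ?_
    filter_upwards [ae_norm_eq_one hν] with z hz
    exact conj_pow_succ_mul hz _ _
  have h2 := integral_szego_snd hν (fun j hj => integral_szego_fst hν hV hj)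
    (by omega : 1 ≤ j + 1) (by omega : j + 1 ≤ n)
  have e : ∀ z : ℂ, conj (z ^ (j + 1)) * ((z - 1) * (R b k n).eval z)
      = leadR b k n * (conj (z ^ (j + 1)) * (z * (szego (beta b k) n).1.eval z))
        - leadR b k n * tau b k n * (conj (z ^ (j + 1)) * (szego (beta b k) n).2.eval z) := by
    intro z
    rw [(sub_one_mul_eval_R h z n).1]; ring
  simp_rw [e]
  rw [integral_sub, integral_const_mul, integral_const_mul, h1, h2]
  · simp
  · exact (integrable_of_continuous hν (by fun_prop)).const_mul _
  · exact (integrable_of_continuous hν (by fun_prop)).const_mul _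

lemma integral_conj_pow_mul_R [IsFiniteMeasure ν] (h : Admissible b.re k)
    (hν : ν (Metric.sphere (0 : ℂ) 1)ᶜ = 0) (hV : HasVerblunskyCoeffs ν (beta b k)) {n j : ℕ}
    (hj : j ≤ n) : ∫ z, conj (z ^ j) * (R b k n).eval z ∂ν = ∫ z, (R b k n).eval z ∂ν := by
  induction j with
  | zero => simp
  | succ j ih =>
    rw [← ih (by omega), eq_comm, ← sub_eq_zero, ← integral_sub
      (integrable_of_continuous hν (by fun_prop)) (integrable_of_continuous hν (by fun_prop)),
      ← integral_sub_one_mul_R h hν hV (by omega : j < n)]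
    refine integral_congr_ae ?_
    filter_upwards [ae_norm_eq_one hν] with z hz
    rw [← conj_pow_succ_mul hz]; ring

lemma integral_R [IsProbabilityMeasure ν] (h : Admissible b.re k)
    (hν : ν (Metric.sphere (0 : ℂ) 1)ᶜ = 0) (hV : HasVerblunskyCoeffs ν (beta b k)) (n : ℕ) :
    ∫ z, (R b k n).eval z ∂ν = 2 ^ n * (gam b.re k n : ℂ) := by
  induction n with
  | zero => simp [R, gam]
  | succ n ih =>
    -- The moment against z is used instead of the one against 1: there Φ_{n+1}^* drops out and
    -- `leadR_tau_szego_snd` leaves 2 (1 - M_{n+1}) ∫ R_n.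
    rw [← integral_conj_pow_mul_R h hν hV (by omega : 1 ≤ n + 1)]
    have h2 := integral_szego_snd hν (fun j hj => integral_szego_fst hν hV hj)
      le_rfl (by omega : 1 ≤ n + 1)
    have e1 : ∫ z, conj (z ^ 1) * (z * (R b k n).eval z) ∂ν = 2 ^ n * (gam b.re k n : ℂ) := by
      rw [← ih]
      refine integral_congr_ae ?_
      filter_upwards [ae_norm_eq_one hν] with z hz
      simpa using conj_pow_succ_mul hz 0 ((R b k n).eval z)
    have e2 : ∀ z : ℂ, conj (z ^ 1) * (R b k (n + 1)).eval z
        = leadR b k (n + 1) * tau b k (n + 1) *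
            (conj (z ^ 1) * (szego (beta b k) (n + 1)).2.eval z)
          + 2 * (1 - (M b.re k (n + 1) : ℂ)) * (conj (z ^ 1) * (z * (R b k n).eval z)) := by
      intro z
      linear_combination (-conj (z ^ 1)) * leadR_tau_szego_snd h z n
    simp_rw [e2]
    rw [integral_add, integral_const_mul, integral_const_mul, h2, e1]
    · simp only [gam]; push_cast; ring
    · exact (integrable_of_continuous hν (by fun_prop)).const_mul _
    · exact (integrable_of_continuous hν (by fun_prop)).const_mul _

/-- On polynomials of degree at most `n`, the functional `q ↦ ∫ z⁻ⁿ q(z) R_n(z) dν` is a multiple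
of the evaluation at `1`. -/
lemma integral_conj_pow_mul_mul_R [IsProbabilityMeasure ν] (h : Admissible b.re k)
    (hν : ν (Metric.sphere (0 : ℂ) 1)ᶜ = 0) (hV : HasVerblunskyCoeffs ν (beta b k)) {n : ℕ}
    {q : ℂ[X]} (hq : q.natDegree ≤ n) :
    ∫ z, conj z ^ n * q.eval z * (R b k n).eval z ∂ν
      = q.eval 1 * (2 ^ n * (gam b.re k n : ℂ)) := by
  have e : ∫ z, conj z ^ n * q.eval z * (R b k n).eval z ∂ν
      = ∫ z, ∑ i ∈ Finset.range (n + 1),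
          q.coeff i * (conj (z ^ (n - i)) * (R b k n).eval z) ∂ν := by
    refine integral_congr_ae ?_
    filter_upwards [ae_norm_eq_one hν] with z hz
    rw [eval_eq_sum_range' (Nat.lt_succ_of_le hq), Finset.mul_sum, Finset.sum_mul]
    refine Finset.sum_congr rfl fun i hi => ?_
    rw [map_pow, ← conj_pow_mul_pow hz (Nat.lt_succ_iff.1 (Finset.mem_range.1 hi))]
    ring
  rw [e, integral_finsetSum]
  · rw [eval_eq_sum_range' (Nat.lt_succ_of_le hq), Finset.sum_mul]
    refine Finset.sum_congr rfl fun i _ => ?_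
    rw [integral_const_mul, integral_conj_pow_mul_R h hν hV (Nat.sub_le n i), integral_R h hν hV]
    simp
  · intro i _
    exact (integrable_of_continuous hν (by fun_prop)).const_mul _

/-- The measure has no mass at the point `1`. -/
lemma measure_one_eq_zero [IsProbabilityMeasure ν] (h : Admissible b.re k)
    (hν : ν (Metric.sphere (0 : ℂ) 1)ᶜ = 0) (hV : HasVerblunskyCoeffs ν (beta b k)) :
    ν {1} = 0 := by
  by_contra hne
  have hpos : 0 < ν.real {1} := (measureReal_nonneg).lt_of_ne' (by
    rw [Ne, measureReal_eq_zero_iff]; exact hne)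
  obtain ⟨n, hn⟩ := h.exists_lt_wallSum (ν.real {1})⁻¹
  have hg := h.gam_pos n
  have hw : 0 < wallSum b.re k n := (inv_pos.2 hpos).trans hn
  -- Take q = R_n in `integral_conj_pow_mul_mul_R`. The atom at 1 alone contributes ν{1} R_n(1)² to
  -- this integral, whence ν{1} W_n ≤ 1.
  have h1 : ∫ z, ‖(R b k n).eval z‖ ^ 2 ∂ν
      = (2 ^ n * (gam b.re k n * wallSum b.re k n)) * (2 ^ n * gam b.re k n) := by
    have h2 := integral_conj_pow_mul_mul_R h hν hV (natDegree_R b k n)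
    rw [eval_one_R h] at h2
    have h3 : ∫ z, conj z ^ n * (R b k n).eval z * (R b k n).eval z ∂ν
        = ∫ z, ((‖(R b k n).eval z‖ ^ 2 : ℝ) : ℂ) ∂ν := by
      refine integral_congr_ae ?_
      filter_upwards [ae_norm_eq_one hν] with z hz
      rw [← conj_eval_R b k hz, mul_comm, Complex.mul_conj, Complex.normSq_eq_norm_sq]
    have h4 := integral_ofReal.symm.trans (h3.symm.trans h2)
    apply Complex.ofReal_injective
    refine h4.trans ?_
    push_cast
    ring
  have hi : Integrable (fun z => ‖(R b k n).eval z‖ ^ 2) ν := by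
    have : Integrable (fun z : ℂ => (R b k n).eval z ^ 2) ν :=
      integrable_of_continuous hν (by fun_prop)
    simpa [norm_pow] using this.norm
  have h5 : ∫ z in {(1 : ℂ)}, ‖(R b k n).eval z‖ ^ 2 ∂ν
      = ν.real {1} * (2 ^ n * (gam b.re k n * wallSum b.re k n)) ^ 2 := by
    rw [integral_singleton, eval_one_R h, Complex.norm_real, Real.norm_eq_abs, sq_abs, smul_eq_mul]
  have h6 := setIntegral_le_integral (s := {(1 : ℂ)}) hi
    (Filter.Eventually.of_forall fun z => by positivity)
  rw [h5, h1] at h6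
  have h7 : ν.real {1} * wallSum b.re k n ≤ 1 := by
    have h8 : 0 < (2 ^ n * gam b.re k n) ^ 2 * wallSum b.re k n := by positivity
    refine le_of_mul_le_mul_right ?_ h8
    calc _ = ν.real {1} * (2 ^ n * (gam b.re k n * wallSum b.re k n)) ^ 2 := by ring
      _ ≤ _ := h6
      _ = _ := by ring
  have h9 : 1 < ν.real {1} * wallSum b.re k n := by
    rwa [inv_lt_iff_one_lt_mul₀' hpos] at hn
  linarith

end CircleOrthogonality

/-! ### Transfer to the real line -/

lemma ofReal_sub_I_ne_zero (x : ℝ) : (x : ℂ) - Complex.I ≠ 0 := by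
  intro h
  simpa using congrArg Complex.im h

lemma ofReal_add_I_ne_zero (x : ℝ) : (x : ℂ) + Complex.I ≠ 0 := by
  intro h
  simpa using congrArg Complex.im h

lemma cayley_sub_one (x : ℝ) : cayley x - 1 = 2 * Complex.I / ((x : ℂ) - Complex.I) := by
  have := ofReal_sub_I_ne_zero x
  unfold cayley
  field_simp
  ring

lemma cayley_add_one (x : ℝ) : cayley x + 1 = 2 * (x : ℂ) / ((x : ℂ) - Complex.I) := by
  have := ofReal_sub_I_ne_zero x
  unfold cayley
  field_simp
  ring

lemma continuous_cayley : Continuous cayley := by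
  unfold cayley
  exact Continuous.div (by fun_prop) (by fun_prop) ofReal_sub_I_ne_zero

lemma cayley_injective : Function.Injective cayley := by
  intro x y hxy
  have h := cayley_sub_one x
  rw [hxy, cayley_sub_one y,
    div_eq_div_iff (ofReal_sub_I_ne_zero y) (ofReal_sub_I_ne_zero x)] at h
  simpa using mul_left_cancel₀ (by simp : 2 * Complex.I ≠ 0) h

lemma conj_cayley (x : ℝ) :
    conj (cayley x) = ((x : ℂ) - Complex.I) / ((x : ℂ) + Complex.I) := by
  simp [cayley, sub_eq_add_neg]

lemma range_cayley : Set.range cayley = Metric.sphere (0 : ℂ) 1 \ {1} := by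
  ext z
  simp only [Set.mem_range, Set.mem_sdiff, mem_sphere_zero_iff_norm, Set.mem_singleton_iff]
  constructor
  · rintro ⟨x, rfl⟩
    constructor
    · have h1 : conj (cayley x) * cayley x = 1 := by
        have := ofReal_sub_I_ne_zero x
        have := ofReal_add_I_ne_zero x
        rw [conj_cayley, cayley]
        field_simp
      have h2 := congrArg norm h1
      rw [norm_mul, Complex.norm_conj, norm_one] at h2
      nlinarith [norm_nonneg (cayley x)]
    · intro h
      have := cayley_sub_one x
      rw [h, sub_self, eq_comm, div_eq_zero_iff] at this
      simp [ofReal_sub_I_ne_zero] at this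
  · rintro ⟨hz, hz1⟩
    have h1 : z - 1 ≠ 0 := sub_ne_zero.2 hz1
    have hzz := conj_mul_self_of_norm hz
    have hc1 : conj z - 1 ≠ 0 := by
      intro h
      rw [sub_eq_zero.1 h, one_mul] at hzz
      exact hz1 hzz
    -- The inverse transform is x = i (z + 1)/(z - 1), which is real for z on the circle.
    have hreal : conj (Complex.I * (z + 1) / (z - 1)) = Complex.I * (z + 1) / (z - 1) := by
      simp only [map_div₀, map_mul, map_add, map_sub, map_one, Complex.conj_I]
      rw [div_eq_div_iff hc1 h1]
      linear_combination -2 * Complex.I * hzz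
    obtain ⟨x, hx⟩ := Complex.conj_eq_iff_real.1 hreal
    refine ⟨x, ?_⟩
    have h2 := ofReal_sub_I_ne_zero x
    have h3 : (x : ℂ) * (z - 1) = Complex.I * (z + 1) := by
      rw [← hx]; field_simp
    rw [cayley, div_eq_iff h2]
    linear_combination -h3

lemma measurableEmbedding_cayley : MeasurableEmbedding cayley :=
  continuous_cayley.measurableEmbedding cayley_injective

lemma map_lineMeasure {ν : Measure ℂ} (hν : ν (Metric.sphere (0 : ℂ) 1)ᶜ = 0) (h1 : ν {1} = 0) :
    (lineMeasure ν).map cayley = ν := by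
  rw [lineMeasure, measurableEmbedding_cayley.map_comap, range_cayley]
  refine Measure.restrict_eq_self_of_ae_mem ?_
  filter_upwards [compl_mem_ae_iff.2 hν, compl_mem_ae_iff.2 h1] with z hz hz1
  exact ⟨by simpa using hz, hz1⟩

section Line

variable (b : ℂ) (k : ℕ)

/-- Both sides satisfy the same recurrence, since (1 + ic)(x + i) + (1 - ic)(x - i) = 2 (x - c) and
(x - i)(x + i) = x² + 1. -/
lemma eval_P_eq (x : ℝ) (n : ℕ) :
    2 ^ n * (((P b k n).eval x : ℝ) : ℂ)
      = ((x : ℂ) - Complex.I) ^ n * (R b k n).eval (cayley x) := by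
  have hx := ofReal_sub_I_ne_zero x
  have hc : ((x : ℂ) - Complex.I) * cayley x = x + Complex.I := by
    unfold cayley; field_simp
  have hI := Complex.I_mul_I
  induction n using Nat.twoStepInduction with
  | zero => simp [P, R]
  | one =>
    simp only [P, R, eval_add, eval_sub, eval_mul, eval_C, eval_X]
    push_cast
    linear_combination (-(1 + Complex.I * (c b (k + 1) : ℂ))) * hc - 2 * (c b (k + 1) : ℂ) * hI
  | more n ih1 ih2 =>
    simp only [P, R, eval_add, eval_sub, eval_mul, eval_C, eval_X, eval_pow, eval_one]
    push_cast
    rw [pow_succ, pow_succ]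
    rw [pow_succ] at ih2
    generalize (R b k n).eval (cayley x) = r at *
    generalize (R b k (n + 1)).eval (cayley x) = r' at *
    linear_combination 2 * ((x : ℂ) - (c b (k + n + 2) : ℂ)) * ih2
      - 4 * (d b.re (k + n + 2) : ℂ) * ((x : ℂ) ^ 2 + 1) * ih1
      + (-((x : ℂ) - Complex.I) ^ n * ((x : ℂ) - Complex.I) * r'
          * (1 + Complex.I * (c b (k + n + 2) : ℂ))
        + 4 * (d b.re (k + n + 2) : ℂ) * ((x : ℂ) - Complex.I) * ((x : ℂ) - Complex.I) ^ n * r)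
          * hc
      - (2 * (c b (k + n + 2) : ℂ) * ((x : ℂ) - Complex.I) ^ n * ((x : ℂ) - Complex.I) * r'
        + 4 * (d b.re (k + n + 2) : ℂ) * ((x : ℂ) - Complex.I) ^ n * r) * hI

/-- The integrand of the orthogonality relation, as a function on the circle. -/
noncomputable def circleIntegrand (n j : ℕ) (z : ℂ) : ℂ :=
  (4 ^ n * Complex.I ^ (n - j))⁻¹ *
    (conj z ^ n * ((X + 1) ^ j * (X - 1) ^ (n - j) : ℂ[X]).eval z * (R b k n).eval z)

lemma continuous_circleIntegrand (n j : ℕ) : Continuous (circleIntegrand b k n j) := by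
  unfold circleIntegrand; fun_prop

/-- Here z + 1 = 2x/(x - i) and z - 1 = 2i/(x - i), which yields 2^n i^{n-j}; R_n supplies the other
2^n of the normalizing constant. -/
lemma circleIntegrand_cayley {n j : ℕ} (hj : j ≤ n) (x : ℝ) :
    circleIntegrand b k n j (cayley x)
      = ((x ^ j * ((P b k n).eval x / (x ^ 2 + 1) ^ n) : ℝ) : ℂ) := by
  have h1 := ofReal_sub_I_ne_zero x
  have h2 := ofReal_add_I_ne_zero x
  have hP := eval_P_eq b k x n
  have hxx : ((x : ℂ) ^ 2 + 1) = ((x : ℂ) - Complex.I) * ((x : ℂ) + Complex.I) := by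
    linear_combination Complex.I_mul_I
  have hR : (R b k n).eval (cayley x)
      = 2 ^ n * (((P b k n).eval x : ℝ) : ℂ) / ((x : ℂ) - Complex.I) ^ n := by
    rw [hP]; field_simp
  obtain ⟨m, rfl⟩ := Nat.exists_eq_add_of_le hj
  rw [circleIntegrand, hR]
  simp only [eval_mul, eval_pow, eval_add, eval_sub, eval_X, eval_one, cayley_sub_one,
    cayley_add_one, conj_cayley, Nat.add_sub_cancel_left]
  push_cast
  rw [hxx]
  have h4 : (4 : ℂ) = 2 * 2 := by norm_num
  simp only [div_pow, mul_pow, pow_add, h4]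
  field_simp

end Line

end CRR

namespace CRR

/-! ### Orthogonality on the real line. -/

section Main

variable {b : ℂ} {k : ℕ} {ν : Measure ℂ} [IsProbabilityMeasure ν]

lemma integrable_line (h : Admissible b.re k)
    (hν : ν (Metric.sphere (0 : ℂ) 1)ᶜ = 0) (hV : HasVerblunskyCoeffs ν (beta b k)) {n j : ℕ}
    (hj : j ≤ n) :
    Integrable (fun x : ℝ => x ^ j * ((P b k n).eval x / (x ^ 2 + 1) ^ n)) (lineMeasure ν) := by
  have h1 := integrable_of_continuous hν (continuous_circleIntegrand b k n j)
  rw [← map_lineMeasure hν (measure_one_eq_zero h hν hV),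
    measurableEmbedding_cayley.integrable_map_iff] at h1
  have h2 := h1.re
  refine h2.congr (Filter.Eventually.of_forall fun x => ?_)
  simp only [Function.comp_apply, circleIntegrand_cayley b k hj]
  exact Complex.ofReal_re _

/-- The orthogonality relations of the associated CRR polynomials. -/
lemma integral_line (h : Admissible b.re k)
    (hν : ν (Metric.sphere (0 : ℂ) 1)ᶜ = 0) (hV : HasVerblunskyCoeffs ν (beta b k)) {n j : ℕ}
    (hj : j ≤ n) :
    ∫ x : ℝ, x ^ j * ((P b k n).eval x / (x ^ 2 + 1) ^ n) ∂(lineMeasure ν)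
      = if n = j then gam b.re k n else 0 := by
  apply Complex.ofReal_injective
  have h1 : ∫ z, circleIntegrand b k n j z ∂ν
      = ∫ x : ℝ, ((x ^ j * ((P b k n).eval x / (x ^ 2 + 1) ^ n) : ℝ) : ℂ) ∂(lineMeasure ν) := by
    conv_lhs => rw [← map_lineMeasure hν (measure_one_eq_zero h hν hV)]
    rw [measurableEmbedding_cayley.integral_map]
    simp only [circleIntegrand_cayley b k hj]
  refine (integral_ofReal.symm.trans h1.symm).trans ?_
  have hdeg : ((X + 1) ^ j * (X - 1) ^ (n - j) : ℂ[X]).natDegree ≤ n := by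
    refine natDegree_mul_le.trans ?_
    have e1 : ((X + 1) ^ j : ℂ[X]).natDegree ≤ j := by
      simpa using natDegree_pow_le_of_le j (natDegree_X_add_C (1 : ℂ)).le
    have e2 : ((X - 1) ^ (n - j) : ℂ[X]).natDegree ≤ n - j := by
      simpa using natDegree_pow_le_of_le (n - j) (natDegree_X_sub_C (1 : ℂ)).le
    omega
  simp only [circleIntegrand]
  rw [integral_const_mul, integral_conj_pow_mul_mul_R h hν hV hdeg]
  simp only [eval_mul, eval_pow, eval_add, eval_sub, eval_X, eval_one, sub_self]
  -- The factor (z - 1)^{n-j} vanishes at 1 unless j = n; then q(1) = 2^n and the powers of 2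
  -- cancel.
  split_ifs with hnj
  · subst hnj
    have h4 : (4 : ℂ) ^ n = 2 ^ n * 2 ^ n := by rw [← mul_pow]; norm_num
    have h5 : (1 + 1 : ℂ) = 2 := by norm_num
    rw [Nat.sub_self, h4, h5]
    field_simp
  · rw [zero_pow (by omega)]
    simp

end Main

/-! ### The associated polynomials as polynomials of the second kind -/

/-- `P_n(t) / (t² + 1)^n`. -/
noncomputable def ratP (b : ℂ) (k n : ℕ) (t : ℝ) : ℝ := (P b k n).eval t / (t ^ 2 + 1) ^ n

lemma ratP_mul (b : ℂ) (k n : ℕ) (t : ℝ) : (t ^ 2 + 1) ^ n * ratP b k n t = (P b k n).eval t := by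
  unfold ratP; field_simp

lemma differentiable_ratP (b : ℂ) (k n : ℕ) : Differentiable ℝ (ratP b k n) := by
  unfold ratP
  exact (P b k n).differentiable.div (by fun_prop) fun t => by positivity

lemma ratP_recurrence (b : ℂ) (k n : ℕ) (t : ℝ) :
    (t ^ 2 + 1) * ratP b k (n + 2) t
      = (t - c b (k + n + 2)) * ratP b k (n + 1) t - d b.re (k + n + 2) * ratP b k n t := by
  have h0 : (t ^ 2 + 1 : ℝ) ^ (n + 1) ≠ 0 := by positivity
  apply mul_left_cancel₀ h0
  have h1 := ratP_mul b k n t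
  have h2 := ratP_mul b k (n + 1) t
  have h3 := ratP_mul b k (n + 2) t
  rw [P] at h3
  simp only [eval_sub, eval_mul, eval_X, eval_C, eval_add, eval_pow, eval_one] at h3
  rw [← h1, ← h2] at h3
  linear_combination h3

/-- The quotient `((1 + x²)^n P_n(t) / (1 + t²)^n - P_n(x)) / (t - x)`, generated by its
recurrence. -/
noncomputable def kernelQuot (b : ℂ) (k : ℕ) (x : ℝ) : ℕ → ℝ → ℝ
  | 0, _ => 0
  | 1, t => 1 - (t + x) * ratP b k 1 t
  | n + 2, t => (x - c b (k + n + 2)) * kernelQuot b k x (n + 1) t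
      - d b.re (k + n + 2) * (x ^ 2 + 1) * kernelQuot b k x n t
      + (1 + x ^ 2) ^ (n + 1) * (ratP b k (n + 1) t - (t + x) * ratP b k (n + 2) t)

lemma differentiable_kernelQuot (b : ℂ) (k : ℕ) (x : ℝ) (n : ℕ) :
    Differentiable ℝ (kernelQuot b k x n) := by
  have hr := differentiable_ratP b k
  induction n using Nat.twoStepInduction with
  | zero => exact differentiable_const _
  | one =>
    have := hr 1
    change Differentiable ℝ fun t => 1 - (t + x) * ratP b k 1 t
    fun_prop
  | more n ih1 ih2 =>
    have := hr (n + 1)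
    have := hr (n + 2)
    change Differentiable ℝ fun t => (x - c b (k + n + 2)) * kernelQuot b k x (n + 1) t
      - d b.re (k + n + 2) * (x ^ 2 + 1) * kernelQuot b k x n t
      + (1 + x ^ 2) ^ (n + 1) * (ratP b k (n + 1) t - (t + x) * ratP b k (n + 2) t)
    fun_prop

/-- The recurrence for `ratP` has t² + 1 in front of the top term. Replacing t² + 1 by x² + 1, and t
- c by x - c, costs multiples of t - x; these are the last summand of `kernelQuot`. -/
lemma sub_mul_kernelQuot (b : ℂ) (k : ℕ) (x t : ℝ) (n : ℕ) :
    (t - x) * kernelQuot b k x n t = (1 + x ^ 2) ^ n * ratP b k n t - (P b k n).eval x := by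
  induction n using Nat.twoStepInduction with
  | zero => simp [kernelQuot, ratP, P]
  | one =>
    have := ratP_mul b k 1 t
    simp only [P, eval_sub, eval_X, eval_C] at this
    simp only [kernelQuot, P, eval_sub, eval_X, eval_C]
    linear_combination -this
  | more n ih1 ih2 =>
    have h := ratP_recurrence b k n t
    simp only [kernelQuot, P, eval_sub, eval_mul, eval_X, eval_C, eval_add, eval_pow, eval_one]
    linear_combination (x - c b (k + n + 2)) * ih2 - d b.re (k + n + 2) * (x ^ 2 + 1) * ih1
      - (1 + x ^ 2) ^ (n + 1) * h

lemma dslope_sub_mul {F : ℝ → ℝ} {x : ℝ} (hF : DifferentiableAt ℝ F x) (t : ℝ) :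
    dslope (fun s => (s - x) * F s) x t = F t := by
  rcases eq_or_ne t x with rfl | ht
  · rw [dslope_same]
    have := ((hasDerivAt_id t).sub_const t).mul hF.hasDerivAt
    exact this.deriv.trans (by simp)
  · exact dslope_sub_smul_of_ne F ht

/-- The numerator is (s - x) times a differentiable function, so `dslope` returns that function, at
s = x too. -/
lemma divDiff_eq (b : ℂ) (k n : ℕ) (x t : ℝ) :
    divDiff b k n x t = (1 + t ^ 2) ^ n * kernelQuot b k x n t := by
  have h : (fun s : ℝ => (1 + x ^ 2) ^ n * (P b k n).eval s - (1 + s ^ 2) ^ n * (P b k n).eval x)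
      = fun s => (s - x) * ((1 + s ^ 2) ^ n * kernelQuot b k x n s) := by
    funext s
    rw [← ratP_mul b k n s]
    linear_combination (-(1 + s ^ 2) ^ n) * sub_mul_kernelQuot b k x s n
  have hd := differentiable_kernelQuot b k x n
  rw [divDiff, h, dslope_sub_mul (F := fun s => (1 + s ^ 2) ^ n * kernelQuot b k x n s)]
  fun_prop

section SecondKind

variable {b : ℂ} {k : ℕ} {ν : Measure ℂ} [IsProbabilityMeasure ν]

/-- Integrals of the `kernelQuot` are multiples of the associated polynomials. -/
lemma integral_kernelQuot (h : Admissible b.re k)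
    (hν : ν (Metric.sphere (0 : ℂ) 1)ᶜ = 0) (hV : HasVerblunskyCoeffs ν (beta b k)) (x : ℝ)
    (n : ℕ) : Integrable (kernelQuot b k x (n + 1)) (lineMeasure ν) ∧
      ∫ t, kernelQuot b k x (n + 1) t ∂(lineMeasure ν)
        = M b.re k 1 * (P b (k + 1) n).eval x := by
  have hi0 : ∀ n, Integrable (ratP b k n) (lineMeasure ν) := fun n => by
    have := integrable_line h hν hV (Nat.zero_le n)
    simp only [pow_zero, one_mul] at this
    exact this
  have hi1 : ∀ n, Integrable (fun t => t * ratP b k (n + 1) t) (lineMeasure ν) := fun n => by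
    simpa [ratP] using integrable_line h hν hV (by omega : 1 ≤ n + 1)
  have h0 : ∀ n, ∫ t, ratP b k (n + 1) t ∂(lineMeasure ν) = 0 := fun n => by
    simpa [ratP] using integral_line h hν hV (Nat.zero_le (n + 1))
  have h1 : ∀ n, ∫ t, t * ratP b k (n + 2) t ∂(lineMeasure ν) = 0 := fun n => by
    simpa [ratP] using integral_line h hν hV (by omega : 1 ≤ n + 2)
  have h11 : ∫ t, t * ratP b k 1 t ∂(lineMeasure ν) = 1 - M b.re k 1 := by
    simpa [ratP, gam] using integral_line h hν hV (le_refl 1)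
  have hic : Integrable (fun _ : ℝ => (1 : ℝ)) (lineMeasure ν) := by
    simpa [P] using integrable_line h hν hV (le_refl 0)
  have hmass : ∫ _ : ℝ, (1 : ℝ) ∂(lineMeasure ν) = 1 := by
    simpa [P, gam, -integral_const] using integral_line h hν hV (le_refl 0)
  -- The inhomogeneous term integrates to zero: `ratP` of index n + 1 is orthogonal to 1, and that
  -- of index n + 2 to both 1 and t.
  have hstep : ∀ n, Integrable (kernelQuot b k x n) (lineMeasure ν) →
      Integrable (kernelQuot b k x (n + 1)) (lineMeasure ν) →
      Integrable (kernelQuot b k x (n + 2)) (lineMeasure ν) ∧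
      ∫ t, kernelQuot b k x (n + 2) t ∂(lineMeasure ν)
        = (x - c b (k + n + 2)) * ∫ t, kernelQuot b k x (n + 1) t ∂(lineMeasure ν)
          - d b.re (k + n + 2) * (x ^ 2 + 1) * ∫ t, kernelQuot b k x n t ∂(lineMeasure ν) := by
    intro n hn hn1
    have e : kernelQuot b k x (n + 2) = fun t =>
        (x - c b (k + n + 2)) * kernelQuot b k x (n + 1) t
          - d b.re (k + n + 2) * (x ^ 2 + 1) * kernelQuot b k x n t
        + (1 + x ^ 2) ^ (n + 1) *
          (ratP b k (n + 1) t - (t * ratP b k (n + 2) t + x * ratP b k (n + 2) t)) := by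
      funext t
      simp only [kernelQuot]; ring
    have i1 : Integrable (fun t => t * ratP b k (n + 2) t + x * ratP b k (n + 2) t)
      (lineMeasure ν) := (hi1 (n + 1)).add ((hi0 _).const_mul x)
    have i2 : Integrable (fun t => ratP b k (n + 1) t
      - (t * ratP b k (n + 2) t + x * ratP b k (n + 2) t)) (lineMeasure ν) := (hi0 _).sub i1
    have i3 : Integrable (fun t => (x - c b (k + n + 2)) * kernelQuot b k x (n + 1) t
      - d b.re (k + n + 2) * (x ^ 2 + 1) * kernelQuot b k x n t) (lineMeasure ν) :=
      (hn1.const_mul _).sub (hn.const_mul _)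
    rw [e]
    refine ⟨i3.add (i2.const_mul _), ?_⟩
    rw [integral_add i3 (i2.const_mul _), integral_sub (hn1.const_mul _) (hn.const_mul _),
      integral_const_mul, integral_const_mul, integral_const_mul, integral_sub (hi0 _) i1,
      integral_add (hi1 (n + 1)) ((hi0 _).const_mul x), integral_const_mul, h0, h0, h1]
    ring
  have hz : Integrable (kernelQuot b k x 0) (lineMeasure ν) ∧
      ∫ t, kernelQuot b k x 0 t ∂(lineMeasure ν) = 0 := by
    have : kernelQuot b k x 0 = fun _ => 0 := by funext t; simp [kernelQuot]
    rw [this]; simp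
  -- At index 1 the function t `ratP` is no longer orthogonal to 1: its integral is γ_1 = 1 - M_1,
  -- which leaves the normalization M_1.
  have hone : Integrable (kernelQuot b k x 1) (lineMeasure ν) ∧
      ∫ t, kernelQuot b k x 1 t ∂(lineMeasure ν) = M b.re k 1 := by
    have e : kernelQuot b k x 1 = fun t => 1 - (t * ratP b k 1 t + x * ratP b k 1 t) := by
      funext t; simp only [kernelQuot]; ring
    have i1 : Integrable (fun t => t * ratP b k 1 t + x * ratP b k 1 t)
      (lineMeasure ν) := (hi1 0).add ((hi0 _).const_mul x)
    rw [e]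
    refine ⟨hic.sub i1, ?_⟩
    rw [integral_sub hic i1, integral_add (hi1 0) ((hi0 _).const_mul x), integral_const_mul,
      hmass, h11, h0]
    ring
  -- The integrals start with 0 and M_1, so index n + 1 for k carries the recurrence coefficients of
  -- index n for k + 1.
  induction n using Nat.twoStepInduction with
  | zero => simpa [P] using hone
  | one =>
    obtain ⟨i, e⟩ := hstep 0 hz.1 hone.1
    refine ⟨i, e.trans ?_⟩
    rw [hone.2, hz.2]
    simp only [P, eval_sub, eval_X, eval_C]
    rw [show k + 0 + 2 = k + 1 + 1 by ring]
    ring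
  | more n ih1 ih2 =>
    obtain ⟨i, e⟩ := hstep (n + 1) ih1.1 ih2.1
    refine ⟨i, e.trans ?_⟩
    rw [ih1.2, ih2.2]
    simp only [P, eval_sub, eval_mul, eval_X, eval_C, eval_add, eval_pow, eval_one]
    rw [show k + (n + 1) + 2 = k + 1 + n + 2 by ring]
    ring

end SecondKind

end CRR

theorem mainTheorem6 (b : ℂ) (k : ℕ)
    (h : (k = 0 ∧ 1 / 2 < b.re) ∨ (1 ≤ k ∧ 0 < b.re)) :
    CRR.IsMaximalParameterSequence (fun n => CRR.d b.re (k + n)) (CRR.M b.re k) ∧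
    ∀ (ν : Measure ℂ) [IsProbabilityMeasure ν], ν (Metric.sphere (0 : ℂ) 1)ᶜ = 0 →
      CRR.HasVerblunskyCoeffs ν (CRR.beta b k) →
      (∀ n j : ℕ, j ≤ n →
        Integrable (fun x : ℝ => x ^ j * ((CRR.P b k n).eval x / (x ^ 2 + 1) ^ n))
          (CRR.lineMeasure ν) ∧
        ∫ x : ℝ, x ^ j * ((CRR.P b k n).eval x / (x ^ 2 + 1) ^ n) ∂(CRR.lineMeasure ν)
          = if n = j then CRR.gam b.re k n else 0) ∧
      (∀ (n : ℕ) (x : ℝ),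
        Integrable (fun t : ℝ =>
          CRR.divDiff b k (n + 1) x t / (CRR.M b.re k 1 * (1 + t ^ 2) ^ (n + 1)))
          (CRR.lineMeasure ν) ∧
        (CRR.P b (k + 1) n).eval x
          = ∫ t : ℝ, CRR.divDiff b k (n + 1) x t / (CRR.M b.re k 1 * (1 + t ^ 2) ^ (n + 1))
              ∂(CRR.lineMeasure ν)) := by
  have hA : CRR.Admissible b.re k := h
  refine ⟨hA.isMaximalParameterSequence, fun ν _ hν hV => ⟨fun n j hj =>
    ⟨CRR.integrable_line hA hν hV hj, CRR.integral_line hA hν hV hj⟩, fun n x => ?_⟩⟩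
  have hM : CRR.M b.re k 1 ≠ 0 := (hA.M_mem 0).1.ne'
  obtain ⟨hi, he⟩ := CRR.integral_kernelQuot hA hν hV x n
  have e : (fun t : ℝ =>
      CRR.divDiff b k (n + 1) x t / (CRR.M b.re k 1 * (1 + t ^ 2) ^ (n + 1)))
      = fun t => (CRR.M b.re k 1)⁻¹ * CRR.kernelQuot b k x (n + 1) t := by
    funext t
    have : (1 + t ^ 2 : ℝ) ≠ 0 := by positivity
    rw [CRR.divDiff_eq]
    field_simp
  rw [e]
  refine ⟨hi.const_mul _, ?_⟩
  rw [integral_const_mul, he, inv_mul_cancel_left₀ hM]
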